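/- Theorem (Non-universality of pivot moves). Let $U$ be a universal prefix-free machine with side information: $U(p,y)$ is a partial computable function of binary strings $p,y$; for every $y$ the set of halting programs $p$ is prefix-free; and for every other such machine $V$ there is a constant $c_V$ such that whenever $V(p,y)=x$ there is $q$ with $|q|\le |p|+c_V$ and $U(q,y)=x$. Let $K(x\mid y)=\min\{|p| : U(p,y)=x\}$, let $K(x)=K(x\mid\text{empty string})$, fix a computable bijective pairing $\langle x,y\rangle$ of binary strings, and write $K(x\mid y,z)=K(x\mid\langle y,z\rangle)$, $K(x,y,z)=K(\langle x,\langle y,z\rangle\rangle)$. For a constant $k$, say that $x$ is $k$-recoverable from $(y,z)$ if $$K(x\mid y,z)\le k\log_2\bigl(\max\{K(x),K(y),K(z)\}+1\bigr)+k ,$$ and that $(x,y,z)$ is a determination with slack constant $k$ if each of $x,y,z$ is $k$-recoverable from the other two. For $n\ge 1$ let $p=p_n$ be the first prime in $[2^n,2^{n+1})$, and represent the elements of $\mathbb F_{p}$ by their binary expansions with exactly $n+1$ digits. Then there are elements $A=A_n\in\mathbb F_{p}^\times$, $C=C_n\in\mathbb F_{p}$, $Z=Z_n\in\mathbb F_{p}^\times$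 for each $n$ such that, with $B=ZA$ and $D=Z+C$, the following hold. (i) There is a constant $c$ such that for all sufficiently large $n$: $$|K(A)-n|,\ |K(C)-n|,\ |K(Z)-n|\ \le\ c\log_2 n,\qquad K(A,C,Z)\ \ge\ 3n-c\log_2 n,$$ and both $(A,B,Z)$ and $(Z,C,D)$ are determinations with slack constant $c$. (ii) For every constant $k$ and all $n$ sufficiently large (depending on $k$), there is no binary string $X$ such that both $(A,C,X)$ and $(B,D,X)$ are determinations with slack constant $k$. Moreover, there is not even a binary string $X$ such that $X$ is $k$-recoverable from $(A,C)$, $X$ is $k$-recoverable from $(B,D)$, and $B$ is $k$-recoverable from $(D,X)$. -/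

import Mathlib

open Filter

namespace AlgInfo

/-- A conditional prefix-free machine: a partial computable function of a program `p` and of a
side-information string `y` such that, for every fixed `y`, no halting program is a proper prefix
of another halting program. -/
structure IsPrefixFreeMachine (V : List Bool → List Bool →. List Bool) : Prop where
  partrec : Partrec₂ V
  prefixFree : ∀ y p q : List Bool, (V p y).Dom → (V q y).Dom → p <+: q → p = q

/-- A universal prefix-free machine: it simulates every prefix-free machine, uniformly in the side
information, at the price of a program that is longer by at most a constant. -/
structure IsUniversalMachine (U : List Bool → List Bool →. List Bool) : Prop
    extends IsPrefixFreeMachine U where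
  simulates : ∀ V : List Bool → List Bool →. List Bool, IsPrefixFreeMachine V →
    ∃ c : ℕ, ∀ p y x : List Bool, x ∈ V p y →
      ∃ q : List Bool, q.length ≤ p.length + c ∧ x ∈ U q y

/-- `K(x ∣ y)`: the length of a shortest program from which `U` computes `x`, given `y` as side
information. -/
noncomputable def condK (U : List Bool → List Bool →. List Bool) (x y : List Bool) : ℕ :=
  sInf {l : ℕ | ∃ p : List Bool, p.length = l ∧ x ∈ U p y}

/-- `K(x)`: no side information, that is, the empty string is provided as side information. -/
noncomputable def kolmK (U : List Bool → List Bool →. List Bool) (x : List Bool) : ℕ :=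
  condK U x []

/-- For a universal machine the minimum that defines `K(x ∣ y)` is over a nonempty set. -/
theorem IsUniversalMachine.exists_program {U : List Bool → List Bool →. List Bool}
    (hU : IsUniversalMachine U) (x y : List Bool) :
    ∃ p : List Bool, p.length = condK U x y ∧ x ∈ U p y := by
  have hV : IsPrefixFreeMachine
      (fun p _ => ((if p = [] then some x else none : Option (List Bool)) : Part (List Bool))) := by
    refine ⟨?_, ?_⟩
    · refine Computable.ofOption (Primrec.to_comp ?_)
      exact Primrec.ite (Primrec.eq.comp Primrec.fst (Primrec.const _)) (Primrec.const _)
        (Primrec.const _)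
    · intro y p q hp hq _
      have h1 : p = [] := by by_contra h; simp [h] at hp
      have h2 : q = [] := by by_contra h; simp [h] at hq
      rw [h1, h2]
  obtain ⟨c, hc⟩ := hU.simulates _ hV
  obtain ⟨q, -, hq⟩ := hc [] y x (by simp)
  exact Nat.sInf_mem (s := {l : ℕ | ∃ p : List Bool, p.length = l ∧ x ∈ U p y}) ⟨_, q, rfl, hq⟩

/-- The bijective base-two numeration of binary strings. -/
def strNum : List Bool → ℕ
  | [] => 0
  | b :: l => 2 * strNum l + (1 + b.toNat)

/-- The inverse of `strNum`. -/
def numStr : ℕ → List Bool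
  | 0 => []
  | n + 1 => n.bodd :: numStr (n / 2)
decreasing_by exact Nat.lt_succ_of_le (Nat.div_le_self n 2)

theorem strNum_numStr (n : ℕ) : strNum (numStr n) = n := by
  induction n using Nat.strong_induction_on with
  | _ n ih =>
    cases n with
    | zero => simp [numStr, strNum]
    | succ m =>
      rw [numStr, strNum, ih (m / 2) (by omega)]
      have h := Nat.bodd_add_div2 m
      rw [Nat.div2_val] at h
      omega

theorem numStr_strNum (x : List Bool) : numStr (strNum x) = x := by
  induction x with
  | nil => simp [numStr, strNum]
  | cons b l ih =>
    have h : strNum (b :: l) = (2 * strNum l + b.toNat) + 1 := by rw [strNum]; omega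
    rw [h, numStr]
    cases b
    · simp [ih]
    · have h2 : (2 * strNum l + 1) / 2 = strNum l := by omega
      simp [h2, ih]

/-- The pairing `⟨x, y⟩` of binary strings: a computable bijection. -/
def strPair (x y : List Bool) : List Bool :=
  numStr (Nat.pair (strNum x) (strNum y))

theorem strPair_bijective :
    Function.Bijective (fun w : List Bool × List Bool => strPair w.1 w.2) := by
  constructor
  · rintro ⟨x, y⟩ ⟨x', y'⟩ h
    have h1 := congrArg strNum h
    simp only [strPair, strNum_numStr, Nat.pair_eq_pair] at h1
    have hx := congrArg numStr h1.1
    have hy := congrArg numStr h1.2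
    simp only [numStr_strNum] at hx hy
    rw [hx, hy]
  · intro w
    refine ⟨(numStr (strNum w).unpair.1, numStr (strNum w).unpair.2), ?_⟩
    simp [strPair, strNum_numStr, numStr_strNum]

/-- `K(x ∣ y, z) ≤ c log (m + 1) + c`, where `m` is the largest of the complexities `K(x)`, `K(y)`,
`K(z)`. This is the relation "`K(x ∣ y, z) = 0` up to logarithmic slack", with the constant of the
slack made explicit. -/
def Recoverable (U : List Bool → List Bool →. List Bool) (c : ℕ) (x y z : List Bool) : Prop :=
  (condK U x (strPair y z) : ℝ) ≤
    c * Real.logb 2 ((max (kolmK U x) (max (kolmK U y) (kolmK U z)) : ℕ) + 1) + c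

/-- A three-way determination with slack constant `c`: each of the three strings is recoverable
from the two others. -/
def IsDetermination (U : List Bool → List Bool →. List Bool) (c : ℕ) (x y z : List Bool) : Prop :=
  Recoverable U c x y z ∧ Recoverable U c y x z ∧ Recoverable U c z x y

/-- The first prime of `[2 ^ n, 2 ^ (n + 1))`, which exists for `n ≥ 1`. -/
noncomputable def firstPrime (n : ℕ) : ℕ :=
  sInf {p : ℕ | p.Prime ∧ p ∈ Set.Ico (2 ^ n) (2 ^ (n + 1))}

theorem firstPrime_mem {n : ℕ} (hn : 1 ≤ n) :
    (firstPrime n).Prime ∧ firstPrime n ∈ Set.Ico (2 ^ n) (2 ^ (n + 1)) := by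
  refine Nat.sInf_mem (s := {p : ℕ | p.Prime ∧ p ∈ Set.Ico (2 ^ n) (2 ^ (n + 1))}) ?_
  obtain ⟨p, hp, h1, h2⟩ := Nat.exists_prime_lt_and_le_two_mul (2 ^ n) (by positivity)
  refine ⟨p, hp, h1.le, lt_of_le_of_ne (by rw [pow_succ]; omega) ?_⟩
  rintro rfl
  exact Nat.Prime.not_prime_pow (by omega : 2 ≤ n + 1) hp

/-- The binary string of length `n + 1` that represents an element of `𝔽_p`, for `p` the first
prime of `[2 ^ n, 2 ^ (n + 1))`: the binary digits of its representative in `{0, …, p - 1}`, least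
significant digit first. -/
noncomputable def fieldStr (n : ℕ) (a : ZMod (firstPrime n)) : List Bool :=
  (List.range (n + 1)).map (fun i => a.val.testBit i)

end AlgInfo

open AlgInfo

namespace AlgInfo

/-! ### Numeration of strings and pairs -/

/-! Read `(a, c)` as the line `b = a (d - c)` over `𝔽_p` and `(d, b) = (z + c, z a)` as a point on
it, so that a triple `(a, c, z)` with `a ≠ 0` is an incidence. A string `X` as in (ii) would be a
label that the line and the point share up to few choices, and that almost determines `b` from `d`.

Counting rules this out for most incidences (`card_labelled_le`). Suppose each "few" is at most `M`.
If a positive proportion of the `p ^ 3` triples were labelled, grouping them by `(a, c, X)` would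
give at most `p ^ 2 M` groups, hence at least of order `p ^ 4 / M` pairs of distinct points with the
same line and label. But two distinct points of such a line determine it, and the pair is fixed by
`b`, `d`, `d'`, one of `M` labels of `(b, d)` and one of `M` values `b'` for `(d', X)`: at most `M ^
2 p ^ 3` pairs. This is impossible when `M ^ 3` is much smaller than `p`.

Few strings have small complexity (`exists_finset`), so complexity at most `n / 12` gives `M` of
order `p ^ (1 / 12)`, and some triple is both incompressible and unlabelled (`exists_generic`).
Logarithmic slack is eventually below `n / 12`, once `K(X)` is known to be linear in `n`
(`eventually_kolmK_le_of_recoverable`). The determinations in (i) are field arithmetic modulo a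
computable prime. -/

theorem strNum_lt (p : List Bool) : strNum p + 1 < 2 ^ (p.length + 1) := by
  induction p with
  | nil => simp [strNum]
  | cons b l ih =>
    have : b.toNat ≤ 1 := Bool.toNat_le b
    rw [strNum, List.length_cons, pow_succ]
    omega

theorem le_strNum (p : List Bool) : 2 ^ p.length ≤ strNum p + 1 := by
  induction p with
  | nil => simp [strNum]
  | cons b l ih =>
    rw [strNum, List.length_cons, pow_succ]
    omega

theorem length_numStr_le (m : ℕ) : 2 ^ (numStr m).length ≤ m + 1 := by
  simpa [strNum_numStr] using le_strNum (numStr m)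

theorem length_strPair_le (x y : List Bool) :
    (strPair x y).length ≤ 2 * (max x.length y.length + 1) := by
  have h := length_numStr_le (Nat.pair (strNum x) (strNum y))
  have h1 := Nat.pair_lt_max_add_one_sq (strNum x) (strNum y)
  have h2 : max (strNum x) (strNum y) + 1 ≤ 2 ^ (max x.length y.length + 1) := by
    rcases le_total (strNum x) (strNum y) with hxy | hxy
    · rw [max_eq_right hxy]
      exact (strNum_lt y).le.trans (Nat.pow_le_pow_right two_pos (by omega))
    · rw [max_eq_left hxy]
      exact (strNum_lt x).le.trans (Nat.pow_le_pow_right two_pos (by omega))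
  have h3 : 2 ^ (strPair x y).length ≤ 2 ^ (2 * (max x.length y.length + 1)) := by
    calc 2 ^ (strPair x y).length ≤ Nat.pair (strNum x) (strNum y) + 1 := h
      _ ≤ (max (strNum x) (strNum y) + 1) ^ 2 := h1
      _ ≤ (2 ^ (max x.length y.length + 1)) ^ 2 := Nat.pow_le_pow_left h2 2
      _ = _ := by rw [← pow_mul, mul_comm]
  exact (Nat.pow_le_pow_iff_right (by norm_num)).1 h3

theorem primrec_strNum : Primrec strNum := by
  have h : Primrec (fun l : List Bool =>
      l.foldr (fun b s => 2 * s + (1 + cond b 1 0)) 0) := by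
    refine Primrec.list_foldr (h := fun _ q => 2 * q.2 + (1 + cond q.1 1 0))
      Primrec.id (Primrec.const 0) ?_
    refine Primrec.nat_add.comp
      (Primrec.nat_mul.comp (Primrec.const 2) (Primrec.snd.comp Primrec.snd))
      (Primrec.nat_add.comp (Primrec.const 1)
        (Primrec.cond (Primrec.fst.comp Primrec.snd) (Primrec.const 1) (Primrec.const 0)))
  refine h.of_eq fun l => ?_
  induction l with
  | nil => rfl
  | cons b l ih => simp only [List.foldr_cons, ih, strNum]; cases b <;> rfl

theorem primrec_numStr : Primrec numStr := by
  have h : Primrec₂ (fun (_ : Unit) n => numStr n) := by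
    -- The list `l` holds the values at all smaller arguments, so `l.length` is the current
    -- argument.
    refine Primrec.nat_strong_rec _ (g := fun _ l => if l.length = 0 then some [] else
      (l[(l.length - 1) / 2]?).map (fun w => (l.length - 1).bodd :: w)) ?_ ?_
    · have hl : Primrec fun q : Unit × List (List Bool) => q.2.length - 1 :=
        Primrec.nat_sub.comp (Primrec.list_length.comp Primrec.snd) (Primrec.const 1)
      refine Primrec.ite (Primrec.eq.comp (Primrec.list_length.comp Primrec.snd)
        (Primrec.const 0)) (Primrec.const _) ?_
      refine Primrec.option_map (Primrec.list_getElem?.comp Primrec.snd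
        (Primrec.nat_div.comp hl (Primrec.const 2))) ?_
      exact Primrec.list_cons.comp (Primrec.nat_bodd.comp (hl.comp Primrec.fst)) Primrec.snd
    · intro _ n
      cases n with
      | zero => simp [numStr]
      | succ m =>
        have : m / 2 < m + 1 := by omega
        simp [numStr, this]
  exact h.comp (Primrec.const ()) Primrec.id

/-! ### Elementary properties of the complexity -/

theorem IsPrefixFreeMachine.exists_condK_le {U V : List Bool → List Bool →. List Bool}
    (hU : IsUniversalMachine U) (hV : IsPrefixFreeMachine V) :
    ∃ c : ℕ, ∀ p y x : List Bool, x ∈ V p y → condK U x y ≤ p.length + c := by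
  obtain ⟨c, hc⟩ := hU.simulates V hV
  refine ⟨c, fun p y x h => ?_⟩
  obtain ⟨q, hq, hx⟩ := hc p y x h
  have h : condK U x y ≤ q.length := Nat.sInf_le ⟨q, rfl, hx⟩
  exact h.trans hq

/-- There are fewer than `2 ^ (m + 1)` programs of length at most `m`, and each has at most one
output. Every counting bound below rests on this. -/
theorem IsUniversalMachine.exists_finset {U : List Bool → List Bool →. List Bool}
    (hU : IsUniversalMachine U) (y : List Bool) (m : ℕ) :
    ∃ S : Finset (List Bool), S.card ≤ 2 ^ (m + 1) ∧ ∀ x, condK U x y ≤ m → x ∈ S := by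
  classical
  refine ⟨(Finset.range (2 ^ (m + 1))).image
    -- Programs that do not halt contribute the harmless value `[]`.
    (fun i => if h : (U (numStr i) y).Dom then (U (numStr i) y).get h else []),
    Finset.card_image_le.trans (by simp), fun x hx => ?_⟩
  obtain ⟨p, hp, hxp⟩ := hU.exists_program x y
  refine Finset.mem_image.2 ⟨strNum p, Finset.mem_range.2 ?_, ?_⟩
  · exact (Nat.lt_of_succ_lt (strNum_lt p)).trans_le
      (Nat.pow_le_pow_right two_pos (by omega))
  · rw [numStr_strNum, dif_pos (Part.dom_iff_mem.2 ⟨x, hxp⟩)]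
    exact Part.get_eq_of_mem hxp _

/-- A machine that halts only on the empty program is prefix-free, and it may apply `f` to its side
information. -/
theorem IsUniversalMachine.condK_computable {U : List Bool → List Bool →. List Bool}
    (hU : IsUniversalMachine U) {f : List Bool → List Bool} (hf : Computable f) :
    ∃ c : ℕ, ∀ y, condK U (f y) y ≤ c := by
  have hV : IsPrefixFreeMachine
      (fun p y => ((if p = [] then some (f y) else none : Option (List Bool)) :
        Part (List Bool))) := by
    refine ⟨?_, ?_⟩
    · refine Computable.ofOption ?_
      refine (Computable.cond (c := fun q : List Bool × List Bool => decide (q.1 = []))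
        (Primrec.eq.decide.to_comp.comp (Computable.fst) (Computable.const []))
        (Computable.option_some.comp (hf.comp Computable.snd)) (Computable.const none)).of_eq ?_
      rintro ⟨p, y⟩
      by_cases h : p = [] <;> simp [h]
    · intro y p q hp hq _
      have h1 : p = [] := by by_contra h; simp [h] at hp
      have h2 : q = [] := by by_contra h; simp [h] at hq
      rw [h1, h2]
  obtain ⟨c, hc⟩ := hV.exists_condK_le hU
  exact ⟨c, fun y => by simpa using hc [] y (f y) (by simp)⟩

/-! ### Self-delimiting headers -/

/-- The self-delimiting code of `w`: its length in unary, followed by `w`. -/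
def selfDelim (w : List Bool) : List Bool :=
  List.replicate w.length true ++ false :: w

theorem length_selfDelim (w : List Bool) : (selfDelim w).length = 2 * w.length + 1 := by
  simp [selfDelim]; omega

/-- Splits a string into the string that its self-delimiting header encodes and the remainder. -/
def parseDelim (r : List Bool) : Option (List Bool × List Bool) :=
  let m := (r.takeWhile id).length
  let w := (r.drop (m + 1)).take m
  let t := r.drop (2 * m + 1)
  -- Reassembling the input rejects malformed strings and makes the parse invertible.
  if selfDelim w ++ t = r then some (w, t) else none

theorem parseDelim_selfDelim (w t : List Bool) : parseDelim (selfDelim w ++ t) = some (w, t) := by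
  have h : ((selfDelim w ++ t).takeWhile id).length = w.length := by
    simp [selfDelim]
  have h1 : (selfDelim w ++ t).drop (w.length + 1) = w ++ t := by
    simp [selfDelim, List.drop_append]
  have h2 : (selfDelim w ++ t).drop (2 * w.length + 1) = t := by
    rw [← length_selfDelim, List.drop_left]
  simp [parseDelim, h, h1, h2]

theorem eq_of_parseDelim {r w t : List Bool} (h : parseDelim r = some (w, t)) :
    r = selfDelim w ++ t := by
  simp only [parseDelim] at h
  split_ifs at h with h1
  simp only [Option.some.injEq, Prod.mk.injEq] at h
  rw [h.1, h.2] at h1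
  exact h1.symm

theorem primrec_selfDelim : Primrec selfDelim := by
  have h : Primrec fun w : List Bool =>
      (List.range w.length).map (fun _ => true) ++ false :: w :=
    Primrec.list_append.comp
      (Primrec.list_map (Primrec.list_range.comp Primrec.list_length) (Primrec.const true).to₂)
      (Primrec.list_cons.comp (Primrec.const false) Primrec.id)
  exact h.of_eq fun w => by simp [selfDelim, List.map_const']

theorem primrec_parseDelim : Primrec parseDelim := by
  have hm : Primrec fun r : List Bool => (r.takeWhile id).length :=
    Primrec.list_length.comp (Primrec.list_takeWhile Primrec.id)
  have hw : Primrec fun r : List Bool =>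
      (r.drop ((r.takeWhile id).length + 1)).take (r.takeWhile id).length :=
    Primrec.list_take.comp hm (Primrec.list_drop.comp (Primrec.succ.comp hm) Primrec.id)
  have ht : Primrec fun r : List Bool => r.drop (2 * (r.takeWhile id).length + 1) :=
    Primrec.list_drop.comp (Primrec.nat_double_succ.comp hm) Primrec.id
  exact Primrec.ite (Primrec.eq.comp
    (Primrec.list_append.comp (primrec_selfDelim.comp hw) ht) Primrec.id)
    (Primrec.option_some.comp (Primrec.pair hw ht)) (Primrec.const none)

/-- A family of prefix-free sets of programs, indexed by a string that the program carries in its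
self-delimiting header, yields a prefix-free machine. -/
theorem IsUniversalMachine.condK_le_header {U : List Bool → List Bool →. List Bool}
    (hU : IsUniversalMachine U) {g : List Bool → List Bool →. List Bool} (hg : Partrec₂ g)
    (hpf : ∀ w p q : List Bool, (g w p).Dom → (g w q).Dom → p <+: q → p = q) :
    ∃ c : ℕ, ∀ w t x y, x ∈ g w t → condK U x y ≤ 2 * w.length + t.length + c := by
  have hV : IsPrefixFreeMachine (fun r _ =>
      ((parseDelim r : Option (List Bool × List Bool)) : Part (List Bool × List Bool)).bind
        (fun q => g q.1 q.2)) := by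
    refine ⟨?_, ?_⟩
    · refine Partrec.bind (Computable.ofOption (primrec_parseDelim.to_comp.comp Computable.fst)) ?_
      exact hg.comp (Computable.fst.comp Computable.snd) (Computable.snd.comp Computable.snd)
    · intro y p q hp hq hpq
      obtain ⟨x, hx⟩ := Part.dom_iff_mem.1 hp
      obtain ⟨x', hx'⟩ := Part.dom_iff_mem.1 hq
      obtain ⟨⟨w, t⟩, h1, h2⟩ := Part.mem_bind_iff.1 hx
      obtain ⟨⟨w', t'⟩, h1', h2'⟩ := Part.mem_bind_iff.1 hx'
      rw [Part.mem_coe, Option.mem_def] at h1 h1'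
      obtain ⟨s, rfl⟩ := hpq
      have e := eq_of_parseDelim h1
      subst e
      -- A halting program and a halting extension of it carry the same header, so prefix-freeness
      -- for that one header applies.
      rw [List.append_assoc, parseDelim_selfDelim] at h1'
      simp only [Option.some.injEq, Prod.mk.injEq] at h1'
      obtain ⟨rfl, rfl⟩ := h1'
      have := hpf w t (t ++ s) (Part.dom_iff_mem.2 ⟨_, h2⟩) (Part.dom_iff_mem.2 ⟨_, h2'⟩)
        (List.prefix_append _ _)
      rw [List.append_assoc, ← this]
  obtain ⟨c, hc⟩ := hV.exists_condK_le hU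
  refine ⟨c + 1, fun w t x y h => ?_⟩
  have := hc (selfDelim w ++ t) y x
    (Part.mem_bind_iff.2 ⟨(w, t), by simp [parseDelim_selfDelim], h⟩)
  rw [List.length_append, length_selfDelim] at this
  omega

/-- The side information itself is put into the header. -/
theorem IsUniversalMachine.kolmK_le_condK_add {U : List Bool → List Bool →. List Bool}
    (hU : IsUniversalMachine U) :
    ∃ c : ℕ, ∀ x y, kolmK U x ≤ condK U x y + 2 * y.length + c := by
  have hg : Partrec₂ (fun w p => U p w) :=
    hU.partrec.comp Computable.snd Computable.fst
  obtain ⟨c, hc⟩ := hU.condK_le_header hg (fun w p q => hU.prefixFree w p q)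
  refine ⟨c, fun x y => ?_⟩
  obtain ⟨p, hp, hx⟩ := hU.exists_program x y
  have := hc y p x [] hx
  rw [kolmK]
  omega

/-- The header holds the length of `x`; strings of one fixed length form a prefix-free set. -/
theorem IsUniversalMachine.kolmK_le_length {U : List Bool → List Bool →. List Bool}
    (hU : IsUniversalMachine U) :
    ∃ c : ℕ, ∀ x, kolmK U x ≤ x.length + 2 * Nat.log 2 (x.length + 1) + c := by
  have hg : Partrec₂ (fun w p : List Bool =>
      ((if p.length = strNum w then some p else none : Option (List Bool)) :
        Part (List Bool))) := by
    refine Computable.ofOption (Primrec.to_comp ?_)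
    exact Primrec.ite (Primrec.eq.comp (Primrec.list_length.comp Primrec.snd)
      (primrec_strNum.comp Primrec.fst)) (Primrec.option_some.comp Primrec.snd) (Primrec.const _)
  obtain ⟨c, hc⟩ := hU.condK_le_header hg (by
    intro w p q hp hq hpq
    have h1 : p.length = strNum w := by by_contra h; simp [h] at hp
    have h2 : q.length = strNum w := by by_contra h; simp [h] at hq
    exact hpq.eq_of_length (h1.trans h2.symm))
  refine ⟨c, fun x => ?_⟩
  have h := hc (numStr x.length) x x [] (by simp [strNum_numStr])
  have h2 := Nat.le_log_of_pow_le (by norm_num) (length_numStr_le x.length)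
  rw [kolmK]
  omega

/-! ### Arithmetic modulo the first prime -/

/-- The shift excludes `n = 0`, where the interval contains no prime and an unbounded search would
not stop. -/
theorem firstPrime_succ_computable : Computable fun n => firstPrime (n + 1) := by
  have hdvd : PrimrecRel fun m q : ℕ => ¬ (2 ≤ m ∧ m ∣ q) := by
    refine PrimrecPred.not (PrimrecPred.and (Primrec.nat_le.comp (Primrec.const 2) Primrec.fst) ?_)
    exact (Primrec.eq.comp (Primrec.nat_mod.comp Primrec.snd Primrec.fst)
      (Primrec.const 0)).of_eq fun q => (Nat.dvd_iff_mod_eq_zero).symm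
  have hprime : PrimrecPred Nat.Prime := by
    refine (PrimrecPred.and (Primrec.nat_le.comp (Primrec.const 2) Primrec.id)
      (hdvd.forall_lt.comp Primrec.id Primrec.id)).of_eq fun q => ?_
    rw [Nat.prime_def_lt']
    refine and_congr_right fun _ => forall_congr' fun m => ?_
    simp only [id]
    tauto
  have hpow : Primrec₂ fun a b : ℕ => a ^ b := Primrec₂.unpaired'.1 Nat.Primrec.pow
  have hP : ComputablePred fun w : ℕ × ℕ =>
      w.2.Prime ∧ w.2 ∈ Set.Ico (2 ^ (w.1 + 1)) (2 ^ (w.1 + 1 + 1)) := by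
    have : PrimrecPred fun w : ℕ × ℕ =>
        w.2.Prime ∧ 2 ^ (w.1 + 1) ≤ w.2 ∧ w.2 < 2 ^ (w.1 + 1 + 1) :=
      PrimrecPred.and (hprime.comp Primrec.snd) (PrimrecPred.and
        (Primrec.nat_le.comp (hpow.comp (Primrec.const 2) (Primrec.succ.comp Primrec.fst))
          Primrec.snd)
        (Primrec.nat_lt.comp Primrec.snd (hpow.comp (Primrec.const 2)
          (Primrec.succ.comp (Primrec.succ.comp Primrec.fst)))))
    exact this.computablePred
  have hex : ∀ n : ℕ, ∃ q : ℕ, q.Prime ∧ q ∈ Set.Ico (2 ^ (n + 1)) (2 ^ (n + 1 + 1)) :=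
    fun n => ⟨_, firstPrime_mem (Nat.le_add_left 1 n)⟩
  classical
  refine (Computable.find hP hex).of_eq fun n => ?_
  exact ((Nat.sInf_def (hex n)).trans (by congr)).symm

/-- The `m` least significant binary digits of `v`, least significant digit first. -/
def binDigits (m v : ℕ) : List Bool := (List.range m).map fun i => v.testBit i

/-- The number whose binary digits are listed, least significant digit first. -/
def ofBinDigits : List Bool → ℕ
  | [] => 0
  | b :: l => 2 * ofBinDigits l + b.toNat

theorem primrec_binDigits : Primrec₂ binDigits := by
  have hpow : Primrec₂ fun a b : ℕ => a ^ b := Primrec₂.unpaired'.1 Nat.Primrec.pow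
  have hbit : Primrec fun w : (ℕ × ℕ) × ℕ => decide (w.1.2 / 2 ^ w.2 % 2 = 1) :=
    (Primrec.eq.comp (Primrec.nat_mod.comp (Primrec.nat_div.comp
      (Primrec.snd.comp Primrec.fst) (hpow.comp (Primrec.const 2) Primrec.snd))
      (Primrec.const 2)) (Primrec.const 1)).decide
  refine (Primrec.list_map (Primrec.list_range.comp Primrec.fst) hbit.to₂).of_eq fun w => ?_
  simp [binDigits, Nat.testBit_eq_decide_div_mod_eq]

theorem primrec_ofBinDigits : Primrec ofBinDigits := by
  have h : Primrec (fun l : List Bool => l.foldr (fun b s => 2 * s + cond b 1 0) 0) := by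
    refine Primrec.list_foldr (h := fun _ q => 2 * q.2 + cond q.1 1 0)
      Primrec.id (Primrec.const 0) ?_
    refine Primrec.nat_add.comp
      (Primrec.nat_mul.comp (Primrec.const 2) (Primrec.snd.comp Primrec.snd))
      (Primrec.cond (Primrec.fst.comp Primrec.snd) (Primrec.const 1) (Primrec.const 0))
  refine h.of_eq fun l => ?_
  induction l with
  | nil => rfl
  | cons b l ih => simp only [List.foldr_cons, ih, ofBinDigits]; cases b <;> rfl

theorem length_binDigits (m v : ℕ) : (binDigits m v).length = m := by simp [binDigits]

theorem binDigits_succ (m v : ℕ) :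
    binDigits (m + 1) v = (v.testBit 0) :: binDigits m (v / 2) := by
  simp [binDigits, List.range_succ_eq_map, Nat.testBit_succ]

theorem ofBinDigits_binDigits {m v : ℕ} (h : v < 2 ^ m) : ofBinDigits (binDigits m v) = v := by
  induction m generalizing v with
  | zero => simp at h; simp [h, binDigits, ofBinDigits]
  | succ m ih =>
    rw [binDigits_succ, ofBinDigits, ih (by rw [pow_succ] at h; omega), Nat.testBit_zero]
    rcases Nat.mod_two_eq_zero_or_one v with h0 | h0 <;> simp [h0] <;> omega

theorem fieldStr_eq (n : ℕ) (a : ZMod (firstPrime n)) :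
    fieldStr n a = binDigits (n + 1) a.val := rfl

theorem length_fieldStr (n : ℕ) (a : ZMod (firstPrime n)) : (fieldStr n a).length = n + 1 :=
  length_binDigits _ _

theorem val_lt_two_pow {n : ℕ} (hn : 1 ≤ n) (a : ZMod (firstPrime n)) :
    a.val < 2 ^ (n + 1) := by
  have : NeZero (firstPrime n) := ⟨(firstPrime_mem hn).1.ne_zero⟩
  exact (ZMod.val_lt a).trans (firstPrime_mem hn).2.2

theorem fieldStr_injective {n : ℕ} (hn : 1 ≤ n) : Function.Injective (fieldStr n) := by
  have : NeZero (firstPrime n) := ⟨(firstPrime_mem hn).1.ne_zero⟩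
  intro a b h
  have := congrArg ofBinDigits h
  rw [fieldStr_eq, fieldStr_eq, ofBinDigits_binDigits (val_lt_two_pow hn a),
    ofBinDigits_binDigits (val_lt_two_pow hn b)] at this
  exact ZMod.val_injective _ this

/-- A field element that is computed by a fixed arithmetic procedure from two others has bounded
complexity relative to them. -/
theorem IsUniversalMachine.condK_fieldStr {U : List Bool → List Bool →. List Bool}
    (hU : IsUniversalMachine U) {op : ℕ → ℕ × ℕ → ℕ} (hop : Primrec₂ op) :
    ∃ c : ℕ, ∀ n, 1 ≤ n → ∀ a b r : ZMod (firstPrime n),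
      r.val = op (firstPrime n) (a.val, b.val) →
      condK U (fieldStr n r) (strPair (fieldStr n a) (fieldStr n b)) ≤ c := by
  have hfst : Computable fun y : List Bool => numStr (strNum y).unpair.1 :=
    (primrec_numStr.comp (Primrec.fst.comp (Primrec.unpair.comp primrec_strNum))).to_comp
  have hsnd : Computable fun y : List Bool => numStr (strNum y).unpair.2 :=
    (primrec_numStr.comp (Primrec.snd.comp (Primrec.unpair.comp primrec_strNum))).to_comp
  have hlen : Computable fun y : List Bool => (numStr (strNum y).unpair.1).length :=
    Computable.list_length.comp hfst
  have hp : Computable fun y : List Bool =>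
      firstPrime ((numStr (strNum y).unpair.1).length - 2 + 1) :=
    firstPrime_succ_computable.comp
      (Primrec.nat_sub.to_comp.comp hlen (Computable.const 2))
  have hf : Computable fun y : List Bool =>
      binDigits (numStr (strNum y).unpair.1).length
        (op (firstPrime ((numStr (strNum y).unpair.1).length - 2 + 1))
          (ofBinDigits (numStr (strNum y).unpair.1),
            ofBinDigits (numStr (strNum y).unpair.2))) :=
    primrec_binDigits.to_comp.comp hlen (hop.to_comp.comp hp
      ((primrec_ofBinDigits.to_comp.comp hfst).pair (primrec_ofBinDigits.to_comp.comp hsnd)))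
  obtain ⟨c, hc⟩ := hU.condK_computable hf
  refine ⟨c, fun n hn a b r hr => ?_⟩
  have h := hc (strPair (fieldStr n a) (fieldStr n b))
  -- The procedure reads `n` off the string length `n + 1`, in the form required by the shifted
  -- prime search; this uses `1 ≤ n`.
  have e : n + 1 - 2 + 1 = n := by omega
  simp only [strPair, strNum_numStr, Nat.unpair_pair, numStr_strNum, length_fieldStr, e] at h
  rw [fieldStr_eq n a, fieldStr_eq n b, ofBinDigits_binDigits (val_lt_two_pow hn a),
    ofBinDigits_binDigits (val_lt_two_pow hn b), ← hr] at h
  exact h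


/-! ### Counting incidences -/

/-- Let every `e = (a, c, z)` in `E` with `a ≠ 0` carry a label `X e` that is one of at most `M`
labels of `(a, c)` and one of at most `M` labels of `(z * a, z + c)`, and suppose that `z * a` is
one of at most `M` elements attached to `(z + c, X e)`. Then `E` is small. -/
theorem card_labelled_le {K σ : Type*} [Field K] [Fintype K] [DecidableEq K] [DecidableEq σ]
    (M T : ℕ) (F G : K → K → Finset σ) (H : K → σ → Finset K)
    (hF : ∀ a c, (F a c).card ≤ M) (hG : ∀ b d, (G b d).card ≤ M) (hH : ∀ d x, (H d x).card ≤ M)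
    (E : Finset (K × K × K)) (X : K × K × K → σ) (h0 : ∀ e ∈ E, e.1 ≠ 0)
    (hXF : ∀ e ∈ E, X e ∈ F e.1 e.2.1)
    (hXG : ∀ e ∈ E, X e ∈ G (e.2.2 * e.1) (e.2.2 + e.2.1))
    (hXH : ∀ e ∈ E, e.2.2 * e.1 ∈ H (e.2.2 + e.2.1) (X e)) :
    T * E.card ≤ T ^ 2 * (Fintype.card K ^ 2 * M) + M ^ 2 * Fintype.card K ^ 3 := by
  set q := Fintype.card K with hq
  let key : K × K × K → (_ : K × K) × σ := fun e => ⟨(e.1, e.2.1), X e⟩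
  let groups : Finset ((_ : K × K) × σ) := Finset.univ.sigma fun w : K × K => F w.1 w.2
  have hgroups : groups.card ≤ q ^ 2 * M := by
    rw [Finset.card_sigma]
    refine (Finset.sum_le_card_nsmul _ _ M fun w _ => hF w.1 w.2).trans ?_
    simp [hq, pow_two]
  have hkey : ∀ e ∈ E, key e ∈ groups := fun e he =>
    Finset.mem_sigma.2 ⟨Finset.mem_univ _, hXF e he⟩
  -- Ordered pairs of distinct triples with the same `a`, `c` and label; they differ only in `z`.
  let pairs : Finset ((K × K × K) × (K × K × K)) :=
    E.offDiag.filter fun w => key w.1 = key w.2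
  have hpairs : pairs.card ≤ M ^ 2 * q ^ 3 := by
    -- Codes `(b, d, d', X, b')` with `X` among the labels of `(b, d)` and `b'` among the elements
    -- attached to `(d', X)`.
    let target : Finset ((_ : (_ : (K × K) × K) × σ) × K) :=
      ((Finset.univ : Finset ((K × K) × K)).sigma fun w => G w.1.1 w.1.2).sigma
        fun w => H w.1.2 w.2
    have ht : target.card ≤ M ^ 2 * q ^ 3 := by
      rw [Finset.card_sigma]
      refine (Finset.sum_le_card_nsmul _ _ M fun w _ => hH w.1.2 w.2).trans ?_
      rw [Finset.card_sigma, smul_eq_mul]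
      refine (Nat.mul_le_mul_right M
        (Finset.sum_le_card_nsmul _ _ M fun w _ => hG w.1.1 w.1.2)).trans ?_
      simp only [Finset.card_univ, Fintype.card_prod, smul_eq_mul, ← hq]
      exact le_of_eq (by ring)
    refine le_trans (Finset.card_le_card_of_injOn
      (fun w => ⟨⟨((w.1.2.2 * w.1.1, w.1.2.2 + w.1.2.1), w.2.2.2 + w.2.2.1), X w.1⟩,
        w.2.2.2 * w.2.1⟩) ?_ ?_) ht
    · rintro ⟨e, e'⟩ hw
      simp only [pairs, Finset.coe_filter, Finset.mem_offDiag, Set.mem_ofPred_eq] at hw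
      obtain ⟨⟨he, he', hne⟩, hk⟩ := hw
      have hX : X e = X e' := by
        have := (Sigma.mk.inj_iff.1 hk).2
        exact eq_of_heq this
      refine Finset.mem_coe.2 (Finset.mem_sigma.2
        ⟨Finset.mem_sigma.2 ⟨Finset.mem_univ _, hXG e he⟩, ?_⟩)
      have := hXH e' he'
      rw [← hX] at this
      exact this
    · rintro ⟨⟨a, c, z⟩, ⟨a', c', z'⟩⟩ hw ⟨⟨a₁, c₁, z₁⟩, ⟨a₁', c₁', z₁'⟩⟩ hw₁ heq
      simp only [pairs, Finset.coe_filter, Finset.mem_offDiag, Set.mem_ofPred_eq, key,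
        Sigma.mk.injEq, Prod.mk.injEq] at hw hw₁
      obtain ⟨⟨he, he', hne⟩, ⟨rfl, rfl⟩, -⟩ := hw
      obtain ⟨⟨he₁, he₁', hne₁⟩, ⟨rfl, rfl⟩, -⟩ := hw₁
      simp only [Sigma.mk.injEq, Prod.mk.injEq] at heq
      obtain ⟨⟨⟨⟨hb, hd⟩, hd'⟩, -⟩, hb'⟩ := heq
      replace hb' := eq_of_heq hb'
      have hz : z ≠ z' := fun h => hne (by simp [h])
      -- The code determines the pair: `d - d' = z - z' ≠ 0` and `b - b' = a (z - z')` give `a`;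
      -- dividing by `a ≠ 0` gives `z` and `z'`, and then `c = d - z`.
      have hzz : z - z' = z₁ - z₁' := by linear_combination hd - hd'
      have ha : a = a₁ := by
        refine mul_left_cancel₀ (sub_ne_zero.2 hz) ?_
        linear_combination hb - hb' - a₁ * hzz
      subst ha
      have ha0 : a ≠ 0 := h0 _ he
      have hz1 : z = z₁ := mul_right_cancel₀ ha0 hb
      have hz1' : z' = z₁' := mul_right_cancel₀ ha0 hb'
      subst hz1 hz1'
      have hc : c = c₁ := by linear_combination hd
      subst hc
      rfl
  have hE : E.card = ∑ g ∈ groups, (E.filter fun e => key e = g).card :=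
    Finset.card_eq_sum_card_fiberwise hkey
  have hP : pairs.card = ∑ g ∈ groups, (E.filter fun e => key e = g).offDiag.card := by
    rw [Finset.card_eq_sum_card_fiberwise (s := pairs) (t := groups) (f := fun w => key w.1)]
    · refine Finset.sum_congr rfl fun g _ => congrArg Finset.card ?_
      ext ⟨e, e'⟩
      simp only [pairs, Finset.mem_filter, Finset.mem_offDiag]
      constructor
      · rintro ⟨⟨⟨h1, h2, h3⟩, h4⟩, h5⟩
        exact ⟨⟨h1, h5⟩, ⟨h2, h4 ▸ h5⟩, h3⟩
      · rintro ⟨⟨h1, h5⟩, ⟨h2, h4⟩, h3⟩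
        exact ⟨⟨⟨h1, h2, h3⟩, h5.trans h4.symm⟩, h5⟩
    · intro w hw
      simp only [pairs, Finset.coe_filter, Finset.mem_offDiag, Set.mem_ofPred_eq] at hw
      exact hkey _ hw.1.1
  -- A group of size `r ≤ T` is charged to `T ^ 2`, a larger one to its `r (r - 1)` ordered pairs.
  -- This replaces the Cauchy–Schwarz inequality.
  have hstep : ∀ r : ℕ, T * r ≤ T ^ 2 + (r * r - r) := by
    intro r
    rcases Nat.lt_or_ge T r with h | h
    · have h1 : T * r + r ≤ r * r := by nlinarith
      omega
    · nlinarith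
  calc T * E.card = ∑ g ∈ groups, T * (E.filter fun e => key e = g).card := by
        rw [hE, Finset.mul_sum]
    _ ≤ ∑ g ∈ groups, (T ^ 2 + (E.filter fun e => key e = g).offDiag.card) := by
        refine Finset.sum_le_sum fun g _ => ?_
        rw [Finset.offDiag_card]
        exact hstep _
    _ = T ^ 2 * groups.card + pairs.card := by
        rw [Finset.sum_add_distrib, ← hP, Finset.sum_const, smul_eq_mul, mul_comm]
    _ ≤ _ := Nat.add_le_add (Nat.mul_le_mul_left _ hgroups) hpairs


/-! ### Existence of generic triples -/

theorem IsUniversalMachine.card_filter_condK_le {U : List Bool → List Bool →. List Bool}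
    (hU : IsUniversalMachine U) {α : Type*} [Fintype α] {f : α → List Bool}
    (hf : Function.Injective f) (y : List Bool) (m : ℕ)
    [DecidablePred fun a => condK U (f a) y ≤ m] :
    (Finset.univ.filter fun a => condK U (f a) y ≤ m).card ≤ 2 ^ (m + 1) := by
  obtain ⟨S, hS, h⟩ := hU.exists_finset y m
  exact (Finset.card_le_card_of_injOn f (fun a ha => h _ (by simpa using ha)) hf.injOn).trans hS

theorem strPair_left_right {x y x' y' : List Bool} (h : strPair x y = strPair x' y') :
    x = x' ∧ y = y' := by
  have := strPair_bijective.1 (a₁ := (x, y)) (a₂ := (x', y')) h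
  simpa using this

/-- For large `n` there are `a`, `c`, `z` that are jointly incompressible and for which no string
can be computed with few additional bits both from `a`, `c` and from `z * a`, `z + c` while helping
to compute `z * a` from `z + c`. -/
theorem IsUniversalMachine.exists_generic {U : List Bool → List Bool →. List Bool}
    (hU : IsUniversalMachine U) {n : ℕ} (hn : 48 ≤ n) :
    ∃ a c z : ZMod (firstPrime n), a ≠ 0 ∧ z ≠ 0 ∧ n ≤ kolmK U (fieldStr n a) + 6 ∧
      n ≤ kolmK U (fieldStr n c) + 6 ∧ n ≤ kolmK U (fieldStr n z) + 6 ∧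
      3 * n ≤ kolmK U (strPair (fieldStr n a) (strPair (fieldStr n c) (fieldStr n z))) + 6 ∧
      ¬ ∃ X : List Bool, condK U X (strPair (fieldStr n a) (fieldStr n c)) ≤ n / 12 ∧
        condK U X (strPair (fieldStr n (z * a)) (fieldStr n (z + c))) ≤ n / 12 ∧
        condK U (fieldStr n (z * a)) (strPair (fieldStr n (z + c)) X) ≤ n / 12 := by
  classical
  have hn1 : 1 ≤ n := by omega
  have hp := firstPrime_mem hn1
  have : Fact (firstPrime n).Prime := ⟨hp.1⟩
  have hinj := fieldStr_injective hn1
  set K := ZMod (firstPrime n) with hK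
  set p := firstPrime n with hpdef
  have hcard : Fintype.card K = p := ZMod.card p
  have hpn : 2 ^ n ≤ p := hp.2.1
  have hp32 : 32 ≤ p := le_trans (by
    calc 32 = 2 ^ 5 := by norm_num
      _ ≤ 2 ^ n := Nat.pow_le_pow_right two_pos (by omega)) hpn
  -- Complexity at most `n - 7` leaves at most `2 ^ (n - 6) ≤ p / 64` elements; likewise for triples
  -- in `lowAll`.
  let lowOne : Finset K := Finset.univ.filter fun a => condK U (fieldStr n a) [] ≤ n - 7
  have hlowOne : 64 * lowOne.card ≤ p := by
    have h : lowOne.card ≤ 2 ^ (n - 7 + 1) := hU.card_filter_condK_le hinj [] (n - 7)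
    calc 64 * lowOne.card ≤ 2 ^ 6 * 2 ^ (n - 7 + 1) := by omega
      _ = 2 ^ n := by rw [← pow_add]; congr 1; omega
      _ ≤ p := hpn
  let lowAll : Finset (K × K × K) := Finset.univ.filter fun e =>
    condK U (strPair (fieldStr n e.1) (strPair (fieldStr n e.2.1) (fieldStr n e.2.2))) []
      ≤ 3 * n - 7
  have hlowAll : 64 * lowAll.card ≤ p ^ 3 := by
    have h : lowAll.card ≤ 2 ^ (3 * n - 7 + 1) := by
      refine hU.card_filter_condK_le (f := fun e : K × K × K =>
        strPair (fieldStr n e.1) (strPair (fieldStr n e.2.1) (fieldStr n e.2.2))) ?_ [] _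
      rintro ⟨a, c, z⟩ ⟨a', c', z'⟩ h
      obtain ⟨h1, h2⟩ := strPair_left_right h
      obtain ⟨h2, h3⟩ := strPair_left_right h2
      exact Prod.ext (hinj h1) (Prod.ext (hinj h2) (hinj h3))
    calc 64 * lowAll.card ≤ 2 ^ 6 * 2 ^ (3 * n - 7 + 1) := by omega
      _ = (2 ^ n) ^ 3 := by rw [← pow_add, ← pow_mul]; congr 1; omega
      _ ≤ p ^ 3 := Nat.pow_le_pow_left hpn 3
  let linked : K × K × K → List Bool → Prop := fun e X =>
    condK U X (strPair (fieldStr n e.1) (fieldStr n e.2.1)) ≤ n / 12 ∧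
      condK U X (strPair (fieldStr n (e.2.2 * e.1)) (fieldStr n (e.2.2 + e.2.1))) ≤ n / 12 ∧
      condK U (fieldStr n (e.2.2 * e.1)) (strPair (fieldStr n (e.2.2 + e.2.1)) X) ≤ n / 12
  let E : Finset (K × K × K) := Finset.univ.filter fun e => e.1 ≠ 0 ∧ ∃ X, linked e X
  have hE : 8 * E.card ≤ p ^ 3 := by
    choose S hS hmem using fun y => hU.exists_finset y (n / 12)
    have hX : ∀ e : K × K × K, ∃ X, e ∈ E → linked e X := fun e => by
      by_cases he : e ∈ E
      · obtain ⟨X, hX⟩ := (Finset.mem_filter.1 he).2.2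
        exact ⟨X, fun _ => hX⟩
      · exact ⟨[], fun h => absurd h he⟩
    choose X hX using hX
    -- With `M` about `p ^ (1 / 12)`, the threshold `T` about `p ^ (1 / 3)` lies well between `M ^
    -- 2` and `p / M`, so both terms of the bound are at most `T * p ^ 3 / 16`.
    have h := card_labelled_le (2 ^ (n / 12 + 1)) (2 ^ (n / 3))
      (fun a c : K => S (strPair (fieldStr n a) (fieldStr n c)))
      (fun b d : K => S (strPair (fieldStr n b) (fieldStr n d)))
      (fun d x => Finset.univ.filter fun b : K =>
        condK U (fieldStr n b) (strPair (fieldStr n d) x) ≤ n / 12)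
      (fun _ _ => hS _) (fun _ _ => hS _) (fun _ _ => hU.card_filter_condK_le hinj _ _) E X
      (fun e he => (Finset.mem_filter.1 he).2.1)
      (fun e he => hmem _ _ (hX e he).1) (fun e he => hmem _ _ (hX e he).2.1)
      (fun e he => Finset.mem_filter.2 ⟨Finset.mem_univ _, (hX e he).2.2⟩)
    rw [hcard] at h
    have h1 : 2 ^ (n / 3) * 2 ^ (n / 12 + 1) * 16 ≤ p := by
      refine le_trans ?_ hpn
      calc 2 ^ (n / 3) * 2 ^ (n / 12 + 1) * 16 = 2 ^ (n / 3 + (n / 12 + 1) + 4) := by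
            rw [pow_add _ _ 4, pow_add _ (n / 3)]; norm_num
        _ ≤ 2 ^ n := Nat.pow_le_pow_right two_pos (by omega)
    have h2 : (2 ^ (n / 12 + 1)) ^ 2 * 16 ≤ 2 ^ (n / 3) := by
      calc (2 ^ (n / 12 + 1)) ^ 2 * 16 = 2 ^ ((n / 12 + 1) * 2 + 4) := by
            rw [pow_add _ _ 4, pow_mul]; norm_num
        _ ≤ 2 ^ (n / 3) := Nat.pow_le_pow_right two_pos (by omega)
    have hT : 0 < 2 ^ (n / 3) := by positivity
    generalize 2 ^ (n / 3) = T at h h1 h2 hT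
    generalize 2 ^ (n / 12 + 1) = M at h h1 h2
    refine Nat.le_of_mul_le_mul_left (c := 2 * T) ?_ (by omega)
    calc 2 * T * (8 * E.card) = 16 * (T * E.card) := by ring
      _ ≤ 16 * (T ^ 2 * (p ^ 2 * M) + M ^ 2 * p ^ 3) := Nat.mul_le_mul_left _ h
      _ = T * p ^ 2 * (T * M * 16) + M ^ 2 * 16 * p ^ 3 := by ring
      _ ≤ T * p ^ 2 * p + T * p ^ 3 :=
          Nat.add_le_add (Nat.mul_le_mul_left _ h1) (Nat.mul_le_mul_right _ h2)
      _ = 2 * T * p ^ 3 := by ring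
  let bad : Finset (K × K × K) :=
    (({0} : Finset K) ×ˢ (Finset.univ : Finset (K × K))) ∪
    ((Finset.univ : Finset K) ×ˢ ((Finset.univ : Finset K) ×ˢ ({0} : Finset K))) ∪
    (lowOne ×ˢ (Finset.univ : Finset (K × K))) ∪
    ((Finset.univ : Finset K) ×ˢ (lowOne ×ˢ (Finset.univ : Finset K))) ∪
    ((Finset.univ : Finset K) ×ˢ ((Finset.univ : Finset K) ×ˢ lowOne)) ∪ lowAll ∪ E
  -- As fractions of `p ^ 3`: two zero conditions at most `1 / 32` each, four low-complexity
  -- conditions at most `1 / 64` each, and `E` at most `1 / 8`, in total at most `1 / 4`.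
  have hbad : bad.card < (Finset.univ : Finset (K × K × K)).card := by
    have hle : bad.card ≤ 1 * (p * p) + p * (p * 1) + lowOne.card * (p * p) +
        p * (lowOne.card * p) + p * (p * lowOne.card) + lowAll.card + E.card := by
      refine (Finset.card_union_le _ _).trans (Nat.add_le_add_right ?_ _)
      refine (Finset.card_union_le _ _).trans (Nat.add_le_add_right ?_ _)
      refine (Finset.card_union_le _ _).trans (Nat.add_le_add ?_ ?_)
      · refine (Finset.card_union_le _ _).trans (Nat.add_le_add ?_ ?_)
        · refine (Finset.card_union_le _ _).trans (Nat.add_le_add ?_ ?_)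
          · refine (Finset.card_union_le _ _).trans (Nat.add_le_add ?_ ?_) <;>
              simp [Finset.card_product, hcard]
          · simp [Finset.card_product, hcard]
        · simp [Finset.card_product, hcard]
      · simp [Finset.card_product, hcard]
    have htot : (Finset.univ : Finset (K × K × K)).card = p ^ 3 := by
      simp [hcard]; ring
    rw [htot]
    have e1 : 32 * (p * p) ≤ p ^ 3 := by
      calc 32 * (p * p) ≤ p * (p * p) := Nat.mul_le_mul_right _ hp32
        _ = p ^ 3 := by ring
    have e2 : 64 * (lowOne.card * (p * p)) ≤ p ^ 3 := by
      calc 64 * (lowOne.card * (p * p)) = 64 * lowOne.card * (p * p) := by ring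
        _ ≤ p * (p * p) := Nat.mul_le_mul_right _ hlowOne
        _ = p ^ 3 := by ring
    have e3 : p * (lowOne.card * p) = lowOne.card * (p * p) := by ring
    have e4 : p * (p * lowOne.card) = lowOne.card * (p * p) := by ring
    have hpos : 0 < p ^ 3 := pow_pos hp.1.pos 3
    rw [e3, e4, mul_one, one_mul] at hle
    omega
  obtain ⟨⟨a, c, z⟩, -, he⟩ := Finset.exists_mem_notMem_of_card_lt_card hbad
  simp only [bad, lowOne, lowAll, E, linked, Finset.mem_union, Finset.mem_product,
    Finset.mem_singleton, Finset.mem_univ, Finset.mem_filter, true_and, and_true, not_or,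
    not_and, not_le] at he
  obtain ⟨⟨⟨⟨⟨⟨h1, h2⟩, h3⟩, h4⟩, h5⟩, h6⟩, h7⟩ := he
  simp only [kolmK]
  exact ⟨a, c, z, h1, h2, by omega, by omega, by omega, by omega, h7 h1⟩


/-! ### Logarithmic slack -/

theorem eventually_mul_logb_add_le (k : ℝ) {ε : ℝ} (hε : 0 < ε) :
    ∀ᶠ t : ℝ in atTop, k * Real.logb 2 (t + 1) + k ≤ ε * t := by
  have h1 : (fun t : ℝ => Real.log (t + 1)) =o[atTop] fun t : ℝ => t := by
    have h := Real.isLittleO_log_id_atTop.comp_tendsto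
      (tendsto_atTop_add_const_right atTop (1 : ℝ) tendsto_id)
    refine h.trans_isBigO ?_
    refine Asymptotics.IsBigO.add (Asymptotics.isBigO_refl _ _) ?_
    exact (Asymptotics.isLittleO_const_id_atTop (1 : ℝ)).isBigO
  have h2 : (fun t : ℝ => k * Real.logb 2 (t + 1) + k) =o[atTop] fun t : ℝ => t := by
    refine Asymptotics.IsLittleO.add (Asymptotics.IsLittleO.const_mul_left ?_ k)
      (Asymptotics.isLittleO_const_id_atTop k)
    simp only [Real.logb, div_eq_inv_mul]
    exact h1.const_mul_left _
  filter_upwards [h2.bound hε, eventually_ge_atTop 0] with t ht h0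
  rw [Real.norm_of_nonneg h0] at ht
  exact (le_abs_self _).trans ht

theorem recoverable_of_condK_le {U : List Bool → List Bool →. List Bool} {c : ℕ}
    {x y z : List Bool} (h : condK U x (strPair y z) ≤ c) : Recoverable U c x y z := by
  rw [Recoverable]
  have h1 : (condK U x (strPair y z) : ℝ) ≤ c := by exact_mod_cast h
  have h2 : 0 ≤ Real.logb 2 ((max (kolmK U x) (max (kolmK U y) (kolmK U z)) : ℕ) + 1 : ℝ) :=
    Real.logb_nonneg (by norm_num) (by simp)
  have h3 : (0 : ℝ) ≤ c := by positivity
  nlinarith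

theorem Recoverable.condK_le {U : List Bool → List Bool →. List Bool} {k : ℕ}
    {x y z : List Bool} (h : Recoverable U k x y z) {m : ℕ}
    (hx : kolmK U x ≤ m) (hy : kolmK U y ≤ m) (hz : kolmK U z ≤ m) :
    (condK U x (strPair y z) : ℝ) ≤ k * Real.logb 2 (m + 1) + k := by
  refine h.trans (add_le_add_left (mul_le_mul_of_nonneg_left ?_ (by positivity)) _)
  refine Real.logb_le_logb_of_le (by norm_num) (by positivity) ?_
  have : max (kolmK U x) (max (kolmK U y) (kolmK U z)) ≤ m := max_le hx (max_le hy hz)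
  have : ((max (kolmK U x) (max (kolmK U y) (kolmK U z)) : ℕ) : ℝ) ≤ m := by exact_mod_cast this
  linarith

theorem IsUniversalMachine.kolmK_fieldStr_le {U : List Bool → List Bool →. List Bool}
    (hU : IsUniversalMachine U) :
    ∃ c : ℕ, ∀ n, 1 ≤ n → ∀ a : ZMod (firstPrime n),
      (kolmK U (fieldStr n a) : ℝ) ≤ n + 2 * Real.logb 2 n + c := by
  obtain ⟨c, hc⟩ := hU.kolmK_le_length
  refine ⟨c + 5, fun n hn a => ?_⟩
  have h := hc (fieldStr n a)
  rw [length_fieldStr] at h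
  have hn' : (1 : ℝ) ≤ n := by exact_mod_cast hn
  have h1 : (Nat.log 2 (n + 1 + 1) : ℝ) ≤ 2 + Real.logb 2 n := by
    calc (Nat.log 2 (n + 1 + 1) : ℝ) ≤ Real.logb 2 ((n + 1 + 1 : ℕ) : ℝ) :=
          Real.natLog_le_logb _ _
      _ ≤ Real.logb 2 (2 ^ 2 * n) :=
          Real.logb_le_logb_of_le (by norm_num) (by positivity) (by push_cast; linarith)
      _ = 2 + Real.logb 2 n := by
          rw [Real.logb_mul (by norm_num) (by positivity), Real.logb_pow]; simp
  have h2 : (kolmK U (fieldStr n a) : ℝ) ≤ n + 1 + 2 * Nat.log 2 (n + 1 + 1) + c := by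
    exact_mod_cast h
  push_cast
  linarith

theorem IsUniversalMachine.kolmK_fieldStr_le_mul {U : List Bool → List Bool →. List Bool}
    (hU : IsUniversalMachine U) :
    ∃ c : ℕ, ∀ n, 1 ≤ n → ∀ a : ZMod (firstPrime n), kolmK U (fieldStr n a) ≤ c * n := by
  obtain ⟨c, hc⟩ := hU.kolmK_le_length
  refine ⟨c + 8, fun n hn a => ?_⟩
  have h := hc (fieldStr n a)
  rw [length_fieldStr] at h
  have h1 : Nat.log 2 (n + 1 + 1) ≤ n + 1 + 1 := Nat.log_le_self _ _
  nlinarith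

/-- A string that is recoverable from two field elements has linearly bounded complexity. -/
theorem IsUniversalMachine.eventually_kolmK_le_of_recoverable
    {U : List Bool → List Bool →. List Bool} (hU : IsUniversalMachine U) :
    ∃ D : ℕ, (∀ n, 1 ≤ n → ∀ a : ZMod (firstPrime n), kolmK U (fieldStr n a) ≤ D * n) ∧
      ∀ k : ℕ, ∀ᶠ n : ℕ in atTop, ∀ (a c : ZMod (firstPrime n)) (X : List Bool),
        Recoverable U k X (fieldStr n a) (fieldStr n c) → kolmK U X ≤ D * n := by
  obtain ⟨c₁, h₁⟩ := hU.kolmK_fieldStr_le_mul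
  obtain ⟨c₂, h₂⟩ := hU.kolmK_le_condK_add
  refine ⟨c₁ + 2 * c₂ + 24, fun n hn a => (h₁ n hn a).trans (Nat.mul_le_mul_right _ (by omega)),
    fun k => ?_⟩
  have hev := (eventually_mul_logb_add_le k (show (0 : ℝ) < 1 / 2 by norm_num)).natCast_atTop
  obtain ⟨N, hN⟩ := eventually_atTop.1 hev
  -- The slack in `hX` involves `K(X)` itself. If `K(X)` exceeded the claimed bound it would be the
  -- largest of the three complexities, the slack would be at most `K(X) / 2`, and describing `X`
  -- through the pair, of length at most `2 (n + 2)`, would give `K(X) ≤ 8 n + 16 + 2 c₂`.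
  filter_upwards [eventually_ge_atTop (max N 1)] with n hn a c X hX
  have hn1 : 1 ≤ n := (le_max_right _ _).trans hn
  have hnN : N ≤ n := (le_max_left _ _).trans hn
  by_contra hlt
  rw [not_le] at hlt
  have hlarge : ∀ b : ZMod (firstPrime n), kolmK U (fieldStr n b) ≤ kolmK U X := fun b => by
    have := h₁ n hn1 b
    nlinarith
  have h3 := hX.condK_le le_rfl (hlarge a) (hlarge c)
  have h4 := hN (kolmK U X) (by nlinarith)
  have h5 := h₂ X (strPair (fieldStr n a) (fieldStr n c))
  have h6 := length_strPair_le (fieldStr n a) (fieldStr n c)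
  rw [length_fieldStr, length_fieldStr, max_self] at h6
  have h7 : (condK U X (strPair (fieldStr n a) (fieldStr n c)) : ℝ) ≤ 1 / 2 * kolmK U X :=
    h3.trans h4
  have h8 : 2 * condK U X (strPair (fieldStr n a) (fieldStr n c)) ≤ kolmK U X := by
    have : (2 : ℝ) * condK U X (strPair (fieldStr n a) (fieldStr n c)) ≤ kolmK U X := by linarith
    exact_mod_cast this
  nlinarith

/-! ### Field elements recovered by arithmetic -/

/-- Reducing modulo `p` inside the procedure lets the arithmetic be checked as an identity in the
field. -/
theorem IsUniversalMachine.condK_fieldStr_cast {U : List Bool → List Bool →. List Bool}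
    (hU : IsUniversalMachine U) {op : ℕ → ℕ × ℕ → ℕ} (hop : Primrec₂ op) :
    ∃ c : ℕ, ∀ n, 1 ≤ n → ∀ a b r : ZMod (firstPrime n),
      r = (op (firstPrime n) (a.val, b.val) : ℕ) →
      condK U (fieldStr n r) (strPair (fieldStr n a) (fieldStr n b)) ≤ c := by
  obtain ⟨c, hc⟩ := hU.condK_fieldStr (op := fun p w => op p w % p)
    (Primrec.nat_mod.comp hop Primrec.fst)
  exact ⟨c, fun n hn a b r hr => hc n hn a b r (by rw [hr, ZMod.val_natCast])⟩

theorem IsUniversalMachine.exists_isDetermination {U : List Bool → List Bool →. List Bool}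
    (hU : IsUniversalMachine U) :
    ∃ c : ℕ, ∀ n, 1 ≤ n → ∀ a c' z : ZMod (firstPrime n), a ≠ 0 → z ≠ 0 →
      IsDetermination U c (fieldStr n a) (fieldStr n (z * a)) (fieldStr n z) ∧
      IsDetermination U c (fieldStr n z) (fieldStr n c') (fieldStr n (z + c')) := by
  have hpow : Primrec₂ fun a b : ℕ => a ^ b := Primrec₂.unpaired'.1 Nat.Primrec.pow
  have hx : Primrec fun w : ℕ × (ℕ × ℕ) => w.2.1 := Primrec.fst.comp Primrec.snd
  have hy : Primrec fun w : ℕ × (ℕ × ℕ) => w.2.2 := Primrec.snd.comp Primrec.snd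
  have hp2 : Primrec fun w : ℕ × (ℕ × ℕ) => w.1 - 2 :=
    Primrec.nat_sub.comp Primrec.fst (Primrec.const 2)
  obtain ⟨c₁, h₁⟩ := hU.condK_fieldStr_cast (op := fun _ w => w.1 * w.2)
    (Primrec.nat_mul.comp hx hy)
  -- Division is multiplication by the power `p - 2`, by Fermat's little theorem.
  obtain ⟨c₂, h₂⟩ := hU.condK_fieldStr_cast (op := fun p w => w.1 * w.2 ^ (p - 2))
    (Primrec.nat_mul.comp hx (hpow.comp hy hp2))
  obtain ⟨c₃, h₃⟩ := hU.condK_fieldStr_cast (op := fun p w => w.2 * w.1 ^ (p - 2))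
    (Primrec.nat_mul.comp hy (hpow.comp hx hp2))
  obtain ⟨c₄, h₄⟩ := hU.condK_fieldStr_cast (op := fun _ w => w.1 + w.2)
    (Primrec.nat_add.comp hx hy)
  obtain ⟨c₅, h₅⟩ := hU.condK_fieldStr_cast (op := fun p w => w.2 + (p - w.1))
    (Primrec.nat_add.comp hy (Primrec.nat_sub.comp Primrec.fst hx))
  refine ⟨c₁ + c₂ + c₃ + c₄ + c₅, fun n hn a c' z ha hz => ?_⟩
  have hp := (firstPrime_mem hn).1
  have : Fact (firstPrime n).Prime := ⟨hp⟩
  have hinv : ∀ u : ZMod (firstPrime n), u ≠ 0 → u * u ^ (firstPrime n - 2) = 1 := fun u hu => by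
    rw [← pow_succ', show firstPrime n - 2 + 1 = firstPrime n - 1 by have := hp.two_le; omega]
    exact ZMod.pow_card_sub_one_eq_one hu
  have hsub : ∀ u : ZMod (firstPrime n), ((firstPrime n - u.val : ℕ) : ZMod (firstPrime n)) = -u :=
    fun u => by rw [Nat.cast_sub (ZMod.val_lt u).le]; simp
  refine ⟨⟨?_, ?_, ?_⟩, ?_, ?_, ?_⟩ <;> apply recoverable_of_condK_le
  · refine (h₂ n hn _ _ _ ?_).trans (by omega)
    push_cast
    rw [ZMod.natCast_zmod_val, ZMod.natCast_zmod_val]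
    linear_combination -a * hinv z hz
  · refine (h₁ n hn _ _ _ ?_).trans (by omega)
    push_cast
    rw [ZMod.natCast_zmod_val, ZMod.natCast_zmod_val]
    ring
  · refine (h₃ n hn _ _ _ ?_).trans (by omega)
    push_cast
    rw [ZMod.natCast_zmod_val, ZMod.natCast_zmod_val]
    linear_combination -z * hinv a ha
  · refine (h₅ n hn _ _ _ ?_).trans (by omega)
    rw [Nat.cast_add, hsub, ZMod.natCast_zmod_val]
    ring
  · refine (h₅ n hn _ _ _ ?_).trans (by omega)
    rw [Nat.cast_add, hsub, ZMod.natCast_zmod_val]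
    ring
  · refine (h₄ n hn _ _ _ ?_).trans (by omega)
    rw [Nat.cast_add, ZMod.natCast_zmod_val, ZMod.natCast_zmod_val]

end AlgInfo

theorem mainTheorem1 (U : List Bool → List Bool →. List Bool) (hU : IsUniversalMachine U) :
    ∃ (A : (n : ℕ) → (ZMod (firstPrime n))ˣ) (C : (n : ℕ) → ZMod (firstPrime n))
      (Z : (n : ℕ) → (ZMod (firstPrime n))ˣ)
      (B : (n : ℕ) → (ZMod (firstPrime n))ˣ) (D : (n : ℕ) → ZMod (firstPrime n)),
      (∀ n, B n = Z n * A n) ∧ (∀ n, D n = Z n + C n) ∧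
      (∃ c : ℕ, ∀ᶠ n : ℕ in atTop,
        |(kolmK U (fieldStr n (A n)) : ℝ) - n| ≤ c * Real.logb 2 n ∧
        |(kolmK U (fieldStr n (C n)) : ℝ) - n| ≤ c * Real.logb 2 n ∧
        |(kolmK U (fieldStr n (Z n)) : ℝ) - n| ≤ c * Real.logb 2 n ∧
        3 * (n : ℝ) - c * Real.logb 2 n ≤
          (kolmK U (strPair (fieldStr n (A n))
            (strPair (fieldStr n (C n)) (fieldStr n (Z n)))) : ℝ) ∧
        IsDetermination U c (fieldStr n (A n)) (fieldStr n (B n)) (fieldStr n (Z n)) ∧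
        IsDetermination U c (fieldStr n (Z n)) (fieldStr n (C n)) (fieldStr n (D n))) ∧
      (∀ k : ℕ, ∀ᶠ n : ℕ in atTop,
        (¬ ∃ X : List Bool,
          IsDetermination U k (fieldStr n (A n)) (fieldStr n (C n)) X ∧
          IsDetermination U k (fieldStr n (B n)) (fieldStr n (D n)) X) ∧
        (¬ ∃ X : List Bool,
          Recoverable U k X (fieldStr n (A n)) (fieldStr n (C n)) ∧
          Recoverable U k X (fieldStr n (B n)) (fieldStr n (D n)) ∧
          Recoverable U k (fieldStr n (B n)) (fieldStr n (D n)) X)) := by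
  have hgen : ∀ n : ℕ, ∃ (a : (ZMod (firstPrime n))ˣ) (c : ZMod (firstPrime n))
      (z : (ZMod (firstPrime n))ˣ), 48 ≤ n →
      (a : ZMod (firstPrime n)) ≠ 0 ∧ (z : ZMod (firstPrime n)) ≠ 0 ∧
      n ≤ kolmK U (fieldStr n a) + 6 ∧
      n ≤ kolmK U (fieldStr n c) + 6 ∧ n ≤ kolmK U (fieldStr n z) + 6 ∧
      3 * n ≤ kolmK U (strPair (fieldStr n a) (strPair (fieldStr n c) (fieldStr n z))) + 6 ∧
      ¬ ∃ X : List Bool, condK U X (strPair (fieldStr n a) (fieldStr n c)) ≤ n / 12 ∧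
        condK U X (strPair (fieldStr n (z * a)) (fieldStr n (z + c))) ≤ n / 12 ∧
        condK U (fieldStr n (z * a)) (strPair (fieldStr n (z + c)) X) ≤ n / 12 := by
    intro n
    by_cases hn : 48 ≤ n
    · obtain ⟨a, c, z, ha, hz, h⟩ := hU.exists_generic hn
      have : Fact (firstPrime n).Prime := ⟨(firstPrime_mem (by omega)).1⟩
      exact ⟨Units.mk0 a ha, c, Units.mk0 z hz, fun _ => ⟨ha, hz, h⟩⟩
    -- Arbitrary values for small `n`, since both (i) and (ii) concern only large `n`.
    · exact ⟨1, 0, 1, fun h => absurd h hn⟩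
  choose A C Z hACZ using hgen
  refine ⟨A, C, Z, fun n => Z n * A n, fun n => Z n + C n, fun _ => rfl, fun _ => rfl, ?_, ?_⟩
  · obtain ⟨c₁, h₁⟩ := hU.kolmK_fieldStr_le
    obtain ⟨c₂, h₂⟩ := hU.exists_isDetermination
    -- The summand `8` absorbs the additive loss `6` of the generic triple and the term `2 * logb 2
    -- n` in the upper bound, as `logb 2 n ≥ 1`.
    refine ⟨c₁ + c₂ + 8, ?_⟩
    filter_upwards [eventually_ge_atTop 48] with n hn
    obtain ⟨ha, hz, hKa, hKc, hKz, hK, -⟩ := hACZ n hn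
    have hlog : 1 ≤ Real.logb 2 n := by
      rw [Real.le_logb_iff_rpow_le (by norm_num) (by positivity)]
      have : (48 : ℝ) ≤ n := by exact_mod_cast hn
      norm_num
      linarith
    have hslack : ∀ a : ZMod (firstPrime n), n ≤ kolmK U (fieldStr n a) + 6 →
        |(kolmK U (fieldStr n a) : ℝ) - n| ≤ (c₁ + c₂ + 8 : ℕ) * Real.logb 2 n := by
      intro a h
      have h' : (n : ℝ) ≤ kolmK U (fieldStr n a) + 6 := by exact_mod_cast h
      have h'' := h₁ n (by omega) a
      have e1 : (c₁ : ℝ) ≤ c₁ * Real.logb 2 n := le_mul_of_one_le_right (by positivity) hlog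
      have e2 : (c₂ : ℝ) ≤ c₂ * Real.logb 2 n := le_mul_of_one_le_right (by positivity) hlog
      have e3 : (0 : ℝ) ≤ c₁ := by positivity
      have e4 : (0 : ℝ) ≤ c₂ := by positivity
      push_cast
      rw [abs_le]
      constructor <;> linarith
    have hmono : ∀ x y z, IsDetermination U c₂ x y z → IsDetermination U (c₁ + c₂ + 8) x y z := by
      have : ∀ x y z, Recoverable U c₂ x y z → Recoverable U (c₁ + c₂ + 8) x y z := by
        intro x y z h
        have h0 : 0 ≤ Real.logb 2 ((max (kolmK U x) (max (kolmK U y) (kolmK U z)) : ℕ) + 1 : ℝ) :=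
          Real.logb_nonneg (by norm_num) (by simp)
        have h1 : (c₂ : ℝ) ≤ (c₁ + c₂ + 8 : ℕ) := by exact_mod_cast (by omega)
        exact h.trans (add_le_add (mul_le_mul_of_nonneg_right h1 h0) h1)
      exact fun x y z h => ⟨this _ _ _ h.1, this _ _ _ h.2.1, this _ _ _ h.2.2⟩
    obtain ⟨hd1, hd2⟩ := h₂ n (by omega) (A n) (C n) (Z n) ha hz
    refine ⟨hslack _ hKa, hslack _ hKc, hslack _ hKz, ?_, ?_, hmono _ _ _ hd2⟩
    · have h' : 3 * (n : ℝ) ≤ kolmK U (strPair (fieldStr n (A n))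
          (strPair (fieldStr n (C n)) (fieldStr n (Z n)))) + 6 := by exact_mod_cast hK
      have e : (8 : ℝ) ≤ (c₁ + c₂ + 8 : ℕ) := by exact_mod_cast (by omega)
      nlinarith
    · rw [Units.val_mul]
      exact hmono _ _ _ hd1
  · intro k
    obtain ⟨D, hD, hDX⟩ := hU.eventually_kolmK_le_of_recoverable
    have hlim : Tendsto (fun n : ℕ => ((D + 1) * n : ℝ)) atTop atTop :=
      tendsto_natCast_atTop_atTop.const_mul_atTop (by positivity)
    -- All complexities involved are at most `(D + 1) * n`, so this `ε` makes the slack at most `n /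
    -- 24`, below the threshold `n / 12` of the generic triple.
    have hsmall := hlim.eventually (eventually_mul_logb_add_le k
      (show (0 : ℝ) < 1 / (24 * (D + 1)) by positivity))
    filter_upwards [hDX k, hsmall, eventually_ge_atTop 48] with n hX hs hn
    have key : ¬ ∃ X : List Bool,
        Recoverable U k X (fieldStr n (A n)) (fieldStr n (C n)) ∧
        Recoverable U k X (fieldStr n (Z n * A n)) (fieldStr n (Z n + C n)) ∧
        Recoverable U k (fieldStr n (Z n * A n)) (fieldStr n (Z n + C n)) X := by
      rintro ⟨X, h1, h2, h3⟩
      have hKX : kolmK U X ≤ (D + 1) * n := (hX _ _ _ h1).trans (by nlinarith)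
      have hKF : ∀ a, kolmK U (fieldStr n a) ≤ (D + 1) * n := fun a =>
        (hD n (by omega) a).trans (by nlinarith)
      have conv : ∀ r : ℕ, (r : ℝ) ≤ k * Real.logb 2 (((D + 1) * n : ℕ) + 1) + k → r ≤ n / 12 := by
        intro r hr
        push_cast at hr
        have e := hr.trans hs
        have e2 : (1 : ℝ) / (24 * (D + 1)) * ((D + 1) * n) = n / 24 := by
          field_simp
        rw [e2, le_div_iff₀ (by norm_num)] at e
        have : r * 24 ≤ n := by exact_mod_cast e
        omega
      exact (hACZ n hn).2.2.2.2.2.2 ⟨X, conv _ (h1.condK_le hKX (hKF _) (hKF _)),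
        conv _ (h2.condK_le hKX (hKF _) (hKF _)), conv _ (h3.condK_le (hKF _) (hKF _) hKX)⟩
    simp only [Units.val_mul]
    exact ⟨fun ⟨X, h1, h2⟩ => key ⟨X, h1.2.2, h2.2.2, h2.1⟩, key⟩
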